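/- For integers $m\ge 3$ and $k\ge 0$ let $F(m,k)$ be the $m$-barrel fullerene, i.e. the cubic planar graph drawn on $k+3$ concentric circles as follows. The innermost and the outermost circle are cycles of length $m$; each of the $k+1$ circles in between is a cycle of length $2m$, whose vertices are joined alternately to a vertex of the next smaller and a vertex of the next larger circle, each pair of consecutive circles being connected by $m$ edges in cyclic order. The bounded faces are thus the inner $m$-gon, a layer of $m$ pentagons, $k$ layers of $m$ hexagons, and a layer of $m$ pentagons, and the outer face is the second $m$-gon. Let $\Phi(G)$ denote the number of perfect matchings of a graph $G$. Theorem. For every $m\ge 3$ the limit $\rho(m)=\lim_{k\to\infty}\Phi(F(m,k))^{1/k}$ exists, and $$\rho(m)=\prod_{j=1}^{\lfloor (m+1)/3\rfloor}\left(2\cos\frac{\pi(2j-1)}{2m}\right)^2 .$$ -/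

import Mathlib

/-- The vertices of the `m`-barrel fullerene `F(m,k)`, drawn on `k + 3` concentric circles.
The innermost and the outermost circle carry `m` vertices each. Each of the `k + 1` circles in
between (numbered by `Fin (k + 1)`, starting from the innermost one) carries `2m` vertices, which
are, in cyclic order,
`ringIn j 0, ringOut j 0, ringIn j 1, ringOut j 1, …, ringIn j (m - 1), ringOut j (m - 1)`;
`ringIn` vertices are joined to the previous (smaller) circle and `ringOut` vertices to the next
(larger) circle. -/
inductive BarrelVertex (m k : ℕ) : Type
  | inner (l : ZMod m) : BarrelVertex m k
  | ringIn (j : Fin (k + 1)) (l : ZMod m) : BarrelVertex m k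
  | ringOut (j : Fin (k + 1)) (l : ZMod m) : BarrelVertex m k
  | outer (l : ZMod m) : BarrelVertex m k

/-- The edges of `F(m,k)`, each listed with one orientation. -/
inductive BarrelEdge (m k : ℕ) : BarrelVertex m k → BarrelVertex m k → Prop
  /-- the inner `m`-gon -/
  | innerCycle (l : ZMod m) : BarrelEdge m k (.inner l) (.inner (l + 1))
  /-- the two kinds of edges of the `j`-th `2m`-cycle -/
  | ringCycle (j : Fin (k + 1)) (l : ZMod m) : BarrelEdge m k (.ringIn j l) (.ringOut j l)
  | ringCycle' (j : Fin (k + 1)) (l : ZMod m) :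
      BarrelEdge m k (.ringOut j l) (.ringIn j (l + 1))
  /-- the outer `m`-gon -/
  | outerCycle (l : ZMod m) : BarrelEdge m k (.outer l) (.outer (l + 1))
  /-- the inner `m`-gon is joined to the first `2m`-cycle; this creates `m` pentagons -/
  | innerSpoke (l : ZMod m) : BarrelEdge m k (.inner l) (.ringIn 0 l)
  /-- consecutive `2m`-cycles are joined; this creates `k` layers of `m` hexagons -/
  | spoke (j : Fin k) (l : ZMod m) : BarrelEdge m k (.ringOut j.castSucc l) (.ringIn j.succ l)
  /-- the last `2m`-cycle is joined to the outer `m`-gon; this creates `m` pentagons -/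
  | outerSpoke (l : ZMod m) : BarrelEdge m k (.ringOut (Fin.last k) l) (.outer l)

/-- The `m`-barrel fullerene `F(m,k)` (for `m ≥ 3`). -/
def barrelFullerene (m k : ℕ) : SimpleGraph (BarrelVertex m k) :=
  SimpleGraph.fromRel (BarrelEdge m k)

/-- `Φ(G)`: the number of perfect matchings of a (finite) graph `G`. -/
noncomputable def numPerfectMatchings {V : Type*} (G : SimpleGraph V) : ℕ :=
  Nat.card {M : G.Subgraph // M.IsPerfectMatching}

/-!
Cut a perfect matching along the layers of spokes and record, in each layer, the set of positions in
`ZMod m` of the spokes that are *not* used. Going through a ring, each element of this set either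
stays or steps back by one, and no two of them collide. So perfect matchings are walks of a transfer
matrix that preserves the number `c` of particles, between states which can be matched inside the
two caps.

Non-colliding particles are free fermions: summing a Slater determinant of plane waves over all
possible steps multiplies it by a scalar, and the colliding steps contribute nothing because the
determinant vanishes there. For `c` consecutive modes this determinant is, up to a constant
factor, the Vandermonde product of the chords between the particles on the circle. The product of
the lengths of the chords is thus a positive eigenvector on the `c`-particle states, for the
eigenvalue `∏ 2 cos (θ / 2)` over the frequencies `θ` of the modes. Since any two `c`-particle
states are connected, this eigenvalue governs the growth of the number of walks.

The caps force `c = 2 p` to be even. Passing from `p - 1` to `p` multiplies the eigenvalue by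
`(2 cos (π (2 p - 1) / (2 m))) ^ 2`, which is at least `1` exactly when the angle is at most
`π / 3`, that is, for `p ≤ ⌊(m + 1) / 3⌋`; hence `p = ⌊(m + 1) / 3⌋` gives the largest eigenvalue.
-/

section Growth

open Filter Asymptotics Topology

theorem tendsto_const_mul_pow_rpow_one_div {A ρ : ℝ} (hA : 0 < A) (hρ : 0 ≤ ρ) :
    Tendsto (fun n : ℕ => (A * ρ ^ n) ^ (1 / (n : ℝ))) atTop (𝓝 ρ) := by
  have h : Tendsto (fun n : ℕ => A ^ (1 / (n : ℝ)) * ρ) atTop (𝓝 (A ^ (0 : ℝ) * ρ)) :=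
    (tendsto_const_nhds.rpow tendsto_one_div_atTop_nhds_zero_nat (.inl hA.ne')).mul_const ρ
  rw [Real.rpow_zero, one_mul] at h
  refine h.congr' ?_
  filter_upwards [eventually_ne_atTop 0] with n hn
  rw [Real.mul_rpow hA.le (pow_nonneg hρ n), one_div, Real.pow_rpow_inv_natCast hρ hn]

theorem tendsto_rpow_one_div_of_isTheta_pow {a : ℕ → ℝ} {ρ : ℝ} (ha : ∀ n, 0 ≤ a n) (hρ : 0 ≤ ρ)
    (h : a =Θ[atTop] fun n => ρ ^ n) :
    Tendsto (fun n : ℕ => a n ^ (1 / (n : ℝ))) atTop (𝓝 ρ) := by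
  obtain ⟨B, hB, hle⟩ := h.isBigO.exists_pos
  obtain ⟨A, hA, hge⟩ := h.symm.isBigO.exists_pos
  refine tendsto_of_tendsto_of_tendsto_of_le_of_le'
    (tendsto_const_mul_pow_rpow_one_div (inv_pos.2 hA) hρ)
    (tendsto_const_mul_pow_rpow_one_div hB hρ) ?_ ?_
  · filter_upwards [hge.bound] with n hn
    rw [Real.norm_of_nonneg (ha n), Real.norm_of_nonneg (pow_nonneg hρ n)] at hn
    exact Real.rpow_le_rpow (by positivity) ((inv_mul_le_iff₀ hA).2 hn) (by positivity)
  · filter_upwards [hle.bound] with n hn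
    rw [Real.norm_of_nonneg (ha n), Real.norm_of_nonneg (pow_nonneg hρ n)] at hn
    exact Real.rpow_le_rpow (ha n) hn (by positivity)

end Growth

section MatrixPowers

open Matrix

variable {S γ : Type*} [Fintype S] [DecidableEq S]

theorem sum_walks_eq_dotProduct_pow_mulVec {R : Type*} [CommSemiring R] (T : Matrix S S R)
    (f g : S → R) (n : ℕ) :
    ∑ X : Fin (n + 1) → S, f (X 0) * (∏ j : Fin n, T (X j.castSucc) (X j.succ)) *
      g (X (Fin.last n)) = f ⬝ᵥ (T ^ n *ᵥ g) := by
  induction n generalizing f with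
  | zero =>
    rw [← (Equiv.funUnique (Fin 1) S).symm.sum_comp]
    simp [dotProduct]
  | succ n ih =>
    rw [← (Fin.consEquiv fun _ => S).sum_comp, Fintype.sum_prod_type, pow_succ', ← mulVec_mulVec]
    simp only [Fin.prod_univ_succ, Fin.consEquiv, Equiv.coe_fn_mk, Fin.cons_zero, Fin.cons_succ,
      Fin.castSucc_zero, ← Fin.succ_last, ← Fin.succ_castSucc, ← mul_assoc]
    refine Finset.sum_congr rfl fun s _ => (ih (f s • T s)).trans ?_
    rw [smul_dotProduct, smul_eq_mul, mulVec]

section Graded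

variable {R : Type*} [CommSemiring R] {T : Matrix S S R} {κ : S → γ}

theorem pow_apply_ne_zero_of_graded (hκ : ∀ i j, T i j ≠ 0 → κ i = κ j) (n : ℕ) {i j : S}
    (h : (T ^ n) i j ≠ 0) : κ i = κ j := by
  induction n generalizing j with
  | zero =>
    rw [pow_zero, one_apply] at h
    exact congrArg κ (by_contra fun hij => h (if_neg hij))
  | succ n ih =>
    rw [pow_succ, mul_apply] at h
    obtain ⟨l, -, hl⟩ := Finset.exists_ne_zero_of_sum_ne_zero h
    exact (ih (left_ne_zero_of_mul hl)).trans (hκ l j (right_ne_zero_of_mul hl))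

theorem pow_mulVec_apply_of_graded {μ : γ → R} {v : S → R} (hκ : ∀ i j, T i j ≠ 0 → κ i = κ j)
    (hv : ∀ i, (T *ᵥ v) i = μ (κ i) * v i) (n : ℕ) (i : S) :
    (T ^ n *ᵥ v) i = μ (κ i) ^ n * v i := by
  induction n generalizing i with
  | zero => simp
  | succ n ih =>
    have hterm (j) : T i j * (T ^ n *ᵥ v) j = μ (κ i) ^ n * (T i j * v j) := by
      by_cases h : T i j = 0
      · simp [h]
      · rw [ih, ← hκ i j h, mul_left_comm]
    calc (T ^ (n + 1) *ᵥ v) i = ∑ j, T i j * (T ^ n *ᵥ v) j := by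
          rw [pow_succ', ← mulVec_mulVec]; rfl
      _ = μ (κ i) ^ n * (T *ᵥ v) i := by simp only [hterm, ← Finset.mul_sum]; rfl
      _ = μ (κ i) ^ (n + 1) * v i := by rw [hv, pow_succ, mul_assoc]

end Graded

section Nonneg

variable {R : Type*} [Semiring R] [PartialOrder R] {T : Matrix S S R}

theorem pow_succ_apply_pos [IsStrictOrderedRing R] (hT : ∀ i j, 0 ≤ T i j) {n : ℕ} {i j l : S}
    (hij : 0 < (T ^ n) i j) (hjl : 0 < T j l) : 0 < (T ^ (n + 1)) i l := by
  rw [pow_succ, mul_apply]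
  exact Finset.sum_pos' (fun s _ => mul_nonneg (pow_apply_nonneg hT n i s) (hT s l))
    ⟨j, Finset.mem_univ j, mul_pos hij hjl⟩

end Nonneg

theorem exists_forall_mem_le_mul {α : Type*} (s : Finset α) (v : α → ℝ) {w : α → ℝ}
    (hv : ∀ i ∈ s, 0 ≤ v i) (hw : ∀ i ∈ s, 0 < w i) : ∃ C, 0 ≤ C ∧ ∀ i ∈ s, v i ≤ C * w i := by
  have hnonneg (i) (hi : i ∈ s) : 0 ≤ v i / w i := div_nonneg (hv i hi) (hw i hi).le
  exact ⟨∑ i ∈ s, v i / w i, Finset.sum_nonneg hnonneg, fun i hi =>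
    (div_le_iff₀ (hw i hi)).1 (Finset.single_le_sum hnonneg hi)⟩

section Perron

open Filter Asymptotics

variable {T : Matrix S S ℝ} {κ : S → γ} {μ : γ → ℝ} {v f g : S → ℝ}

theorem exists_dotProduct_pow_mulVec_le {ρ : ℝ} (hT : ∀ i j, 0 ≤ T i j)
    (hκ : ∀ i j, T i j ≠ 0 → κ i = κ j) (hv : ∀ i, 0 < v i)
    (hTv : ∀ i, (T *ᵥ v) i = μ (κ i) * v i) (hf : ∀ i, 0 ≤ f i) (hg : ∀ i, 0 ≤ g i)
    (hρ : ∀ i, f i ≠ 0 → |μ (κ i)| ≤ ρ) : ∃ C, ∀ n : ℕ, f ⬝ᵥ (T ^ n *ᵥ g) ≤ C * ρ ^ n := by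
  obtain ⟨C, hC, hgv⟩ := exists_forall_mem_le_mul Finset.univ g (fun i _ => hg i) fun i _ => hv i
  refine ⟨∑ i, f i * (C * v i), fun n => ?_⟩
  rw [Finset.sum_mul]
  refine Finset.sum_le_sum fun i _ => ?_
  by_cases hi : f i = 0
  · simp [hi]
  rw [mul_assoc]
  refine mul_le_mul_of_nonneg_left ?_ (hf i)
  calc (T ^ n *ᵥ g) i ≤ (T ^ n *ᵥ (C • v)) i :=
        dotProduct_le_dotProduct_of_nonneg_left (fun j => hgv j (Finset.mem_univ j))
          (pow_apply_nonneg hT n i)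
    _ = C * v i * μ (κ i) ^ n := by
        rw [mulVec_smul, Pi.smul_apply, pow_mulVec_apply_of_graded hκ hTv, smul_eq_mul]
        ring
    _ ≤ C * v i * ρ ^ n := by
        refine mul_le_mul_of_nonneg_left ?_ (mul_nonneg hC (hv i).le)
        exact (le_abs_self _).trans ((abs_pow _ _).trans_le
          (pow_le_pow_left₀ (abs_nonneg _) (hρ i hi) n))

theorem exists_le_mul_pow_mulVec_apply {i₀ : S} {N : ℕ} (hT : ∀ i j, 0 ≤ T i j)
    (hκ : ∀ i j, T i j ≠ 0 → κ i = κ j) (hv : ∀ i, 0 < v i)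
    (hTv : ∀ i, (T *ᵥ v) i = μ (κ i) * v i) (hg : ∀ i, 0 ≤ g i)
    (hN : ∀ i, κ i = κ i₀ → 0 < (T ^ N) i i₀) (hg₀ : 0 < g i₀) :
    ∃ C, 0 ≤ C ∧ ∀ n : ℕ, μ (κ i₀) ^ n ≤ C * (T ^ (n + N) *ᵥ g) i₀ := by
  classical
  have hpos (i) (hi : i ∈ Finset.univ.filter fun i => κ i = κ i₀) : 0 < (T ^ N *ᵥ g) i :=
    Finset.sum_pos' (fun j _ => mul_nonneg (pow_apply_nonneg hT N i j) (hg j))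
      ⟨i₀, Finset.mem_univ i₀, mul_pos (hN i (Finset.mem_filter.1 hi).2) hg₀⟩
  obtain ⟨C, hC₀, hC⟩ := exists_forall_mem_le_mul _ v (fun i _ => (hv i).le) hpos
  have hle (n : ℕ) : μ (κ i₀) ^ n * v i₀ ≤ C * (T ^ (n + N) *ᵥ g) i₀ := by
    rw [← pow_mulVec_apply_of_graded hκ hTv, pow_add, ← mulVec_mulVec, mulVec, mulVec, dotProduct,
      dotProduct, Finset.mul_sum]
    refine Finset.sum_le_sum fun i _ => ?_
    by_cases h : (T ^ n) i₀ i = 0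
    · simp [h]
    rw [mul_left_comm]
    exact mul_le_mul_of_nonneg_left
      (hC i (by simp [pow_apply_ne_zero_of_graded hκ n h])) (pow_apply_nonneg hT n i₀ i)
  refine ⟨C / v i₀, div_nonneg hC₀ (hv i₀).le, fun n => ?_⟩
  rw [div_mul_eq_mul_div, le_div_iff₀ (hv i₀)]
  exact hle n

theorem isTheta_dotProduct_pow_mulVec {i₀ : S} {N : ℕ} (hT : ∀ i j, 0 ≤ T i j)
    (hκ : ∀ i j, T i j ≠ 0 → κ i = κ j) (hv : ∀ i, 0 < v i)
    (hTv : ∀ i, (T *ᵥ v) i = μ (κ i) * v i) (hf : ∀ i, 0 ≤ f i) (hg : ∀ i, 0 ≤ g i)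
    (hmax : ∀ i, f i ≠ 0 → |μ (κ i)| ≤ μ (κ i₀)) (hN : ∀ i, κ i = κ i₀ → 0 < (T ^ N) i i₀)
    (hf₀ : 0 < f i₀) (hg₀ : 0 < g i₀) :
    (fun n : ℕ => f ⬝ᵥ (T ^ n *ᵥ g)) =Θ[atTop] fun n => μ (κ i₀) ^ n := by
  have hnonneg (n : ℕ) : 0 ≤ T ^ n *ᵥ g := fun i =>
    dotProduct_nonneg_of_nonneg (pow_apply_nonneg hT n i) hg
  have hρ : 0 ≤ μ (κ i₀) := (abs_nonneg _).trans (hmax i₀ hf₀.ne')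
  constructor
  · obtain ⟨C, hC⟩ := exists_dotProduct_pow_mulVec_le hT hκ hv hTv hf hg hmax
    refine .of_bound C (.of_forall fun n => ?_)
    rw [Real.norm_of_nonneg (dotProduct_nonneg_of_nonneg hf (hnonneg n)),
      Real.norm_of_nonneg (pow_nonneg hρ n)]
    exact hC n
  · obtain ⟨C, hC₀, hC⟩ := exists_le_mul_pow_mulVec_apply hT hκ hv hTv hg hN hg₀
    have hlow (n : ℕ) : ‖μ (κ i₀) ^ n‖ ≤ C / f i₀ * ‖f ⬝ᵥ (T ^ (n + N) *ᵥ g)‖ := by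
      rw [Real.norm_of_nonneg (dotProduct_nonneg_of_nonneg hf (hnonneg _)),
        Real.norm_of_nonneg (pow_nonneg hρ n)]
      calc μ (κ i₀) ^ n ≤ C / f i₀ * (f i₀ * (T ^ (n + N) *ᵥ g) i₀) := by
            rw [← mul_assoc, div_mul_cancel₀ _ hf₀.ne']
            exact hC n
        _ ≤ C / f i₀ * (f ⬝ᵥ (T ^ (n + N) *ᵥ g)) :=
            mul_le_mul_of_nonneg_left (Finset.single_le_sum
              (fun i _ => mul_nonneg (hf i) (hnonneg _ i)) (Finset.mem_univ i₀))
              (div_nonneg hC₀ hf₀.le)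
    rw [← map_add_atTop_eq_nat N, isBigO_map]
    refine ((IsBigO.of_bound _ (.of_forall hlow)).const_mul_left (μ (κ i₀) ^ N)).congr_left ?_
    exact fun n => by rw [Function.comp_apply, pow_add, mul_comm]

end Perron

end MatrixPowers

section MoveBack

variable {ι R S : Type*} [DecidableEq ι] [Ring R] [Ring S]

/-- The positions of the particles `x` after those outside `s` have moved back by one step. -/
def moveBack (x : ι → R) (s : Finset ι) : ι → R := s.piecewise x fun i => x i - 1

theorem comp_moveBack (f : R →+* S) (x : ι → R) (s : Finset ι) :
    f ∘ moveBack x s = moveBack (f ∘ x) s := by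
  ext i
  by_cases h : i ∈ s <;> simp [moveBack, h]

end MoveBack

section PlaneWaves

open Finset Complex

/-- The Slater determinant of the plane waves with angular frequencies `θ`, evaluated at the
positions `x`. -/
noncomputable def planeWaveDet {ι : Type*} [Fintype ι] [DecidableEq ι] (θ x : ι → ℝ) : ℂ :=
  Matrix.det fun i j => exp (θ j * x i * I)

theorem sum_planeWaveDet_moveBack {ι : Type*} [Fintype ι] [DecidableEq ι] (θ x : ι → ℝ) :
    ∑ s : Finset ι, planeWaveDet θ (moveBack x s) =
      (∏ j, (1 + exp (-θ j * I))) * planeWaveDet θ x := by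
  let wave : (ι → ℝ) → ι → ι → ℂ := fun x i j => exp (θ j * x i * I)
  have hwave (s : Finset ι) :
      s.piecewise (wave x) (wave fun i => x i - 1) = wave (moveBack x s) := by
    funext i j
    by_cases h : i ∈ s <;> simp [wave, moveBack, h]
  have hadd : wave x + wave (fun i => x i - 1) = fun i j => (1 + exp (-θ j * I)) * wave x i j := by
    funext i j
    simp only [wave, Pi.add_apply, add_mul, one_mul, ← exp_add]
    congr 2
    push_cast
    ring
  have hdet := Matrix.detRowAlternating.map_add_univ (wave x) (wave fun i => x i - 1)
  simp only [hwave, hadd] at hdet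
  exact hdet.symm.trans (Matrix.det_mul_row _ _)

/-- Up to a constant, the Slater determinant of `c` consecutive modes of spacing `2 * δ`. -/
noncomputable def sinProd (δ : ℝ) {c : ℕ} (x : Fin c → ℝ) : ℝ :=
  ∏ i, ∏ j ∈ Ioi i, Real.sin (δ * (x j - x i))

/-- The angular frequencies of `c` consecutive modes of spacing `2 * δ`, placed symmetrically
about `0`. -/
noncomputable def modeAngle (δ : ℝ) (c : ℕ) (j : Fin c) : ℝ := δ * (2 * j - (c - 1))

/-- The eigenvalue, for a step of the dynamics, of the Slater determinant of `c` consecutive modes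
of spacing `2 * δ`. -/
noncomputable def cosProd (δ : ℝ) (c : ℕ) : ℝ := ∏ j, 2 * Real.cos (modeAngle δ c j / 2)

theorem prod_prod_Ioi_mul_eq_prod_pow {M : Type*} [CommMonoid M] {c : ℕ} (w : Fin c → M) :
    ∏ i, ∏ j ∈ Ioi i, w i * w j = ∏ i, w i ^ (c - 1) := by
  refine (prod_prod_Ioi_mul_eq_prod_prod_off_diag fun _ i => w i).trans ?_
  simp [card_compl]

theorem exp_sq_sub_exp_sq (a b : ℂ) : exp (b * I) ^ 2 - exp (a * I) ^ 2 =
    exp (a * I) * exp (b * I) * (2 * I * sin (b - a)) := by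
  simp only [sin, neg_sub, sub_mul, exp_sub]
  field_simp
  rw [I_sq]
  ring

theorem planeWaveDet_modeAngle (δ : ℝ) {c : ℕ} (x : Fin c → ℝ) :
    planeWaveDet (modeAngle δ c) x = (∏ i : Fin c, ∏ _j ∈ Ioi i, 2 * I) * sinProd δ x := by
  set w : Fin c → ℂ := fun i => exp ((δ * x i : ℝ) * I) with hw
  have hw₀ : ∏ i, w i ^ (c - 1) ≠ 0 := prod_ne_zero_iff.2 fun i _ => pow_ne_zero _ (exp_ne_zero _)
  have hwave (i j : Fin c) : exp (modeAngle δ c j * x i * I) =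
      (w i ^ (c - 1))⁻¹ * Matrix.vandermonde (fun i => w i ^ 2) i j := by
    have hc : 1 ≤ c := j.pos
    simp only [Matrix.vandermonde_apply, hw, ← exp_nat_mul, ← exp_neg, ← exp_add]
    congr 1
    push_cast [modeAngle, Nat.cast_sub hc]
    ring
  have hsub (i j : Fin c) : w j ^ 2 - w i ^ 2 =
      w i * w j * (2 * I * Real.sin (δ * (x j - x i))) := by
    rw [hw, exp_sq_sub_exp_sq, ← ofReal_sub, ← ofReal_sin, mul_sub]
  calc planeWaveDet (modeAngle δ c) x
      = (∏ i, w i ^ (c - 1))⁻¹ * ∏ i, ∏ j ∈ Ioi i, (w j ^ 2 - w i ^ 2) := by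
        rw [planeWaveDet, ← Matrix.det_vandermonde, ← prod_inv_distrib, ← Matrix.det_mul_column]
        exact congrArg Matrix.det (Matrix.ext hwave)
    _ = (∏ i : Fin c, ∏ _j ∈ Ioi i, 2 * I) * sinProd δ x := by
        rw [inv_mul_eq_iff_eq_mul₀ hw₀, ← prod_prod_Ioi_mul_eq_prod_pow]
        simp only [sinProd, ofReal_prod, ← prod_mul_distrib, hsub]

theorem sum_modeAngle (δ : ℝ) (c : ℕ) : ∑ j, modeAngle δ c j = 0 := by
  have h : ∑ j, modeAngle δ c j = ∑ j, -modeAngle δ c j := by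
    rw [← Equiv.sum_comp Fin.revPerm]
    refine sum_congr rfl fun j _ => ?_
    simp only [modeAngle, Fin.revPerm_apply, Fin.val_rev, Nat.cast_sub j.isLt]
    push_cast
    ring
  rw [sum_neg_distrib] at h
  linarith

theorem one_add_exp_neg_mul_I (θ : ℂ) :
    1 + exp (-θ * I) = exp (-(θ / 2) * I) * (2 * cos (θ / 2)) := by
  rw [cos, mul_div_cancel₀ _ two_ne_zero, mul_add, ← exp_add, ← exp_add, ← exp_zero]
  congr 2 <;> ring

theorem prod_one_add_exp_modeAngle (δ : ℝ) (c : ℕ) :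
    ∏ j, (1 + exp (-modeAngle δ c j * I)) = cosProd δ c := by
  have hphase : ∏ j, exp (-(modeAngle δ c j / 2) * I) = 1 := by
    rw [← exp_sum, ← sum_mul, sum_neg_distrib, ← sum_div, ← ofReal_sum, sum_modeAngle]
    simp
  simp only [one_add_exp_neg_mul_I, prod_mul_distrib, hphase, one_mul]
  simp [cosProd, prod_mul_distrib]

theorem sum_sinProd_moveBack (δ : ℝ) {c : ℕ} (x : Fin c → ℝ) :
    ∑ s, sinProd δ (moveBack x s) = cosProd δ c * sinProd δ x := by
  have hK : ∏ i : Fin c, ∏ _j ∈ Ioi i, 2 * I ≠ 0 :=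
    prod_ne_zero_iff.2 fun i _ => prod_ne_zero_iff.2 fun j _ => mul_ne_zero two_ne_zero I_ne_zero
  have h := sum_planeWaveDet_moveBack (modeAngle δ c) x
  simp only [planeWaveDet_modeAngle, prod_one_add_exp_modeAngle, ← mul_sum] at h
  rw [mul_left_comm] at h
  exact_mod_cast mul_left_cancel₀ hK h

end PlaneWaves

section DominantMode

open Finset Real

theorem cosProd_add_two (δ : ℝ) (c : ℕ) :
    cosProd δ (c + 2) = (2 * cos (δ * (c + 1) / 2)) ^ 2 * cosProd δ c := by
  have hmid (j : Fin c) : modeAngle δ (c + 2) j.succ.castSucc = modeAngle δ c j := by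
    simp only [modeAngle, Fin.val_castSucc, Fin.val_succ]
    push_cast
    ring
  have hfirst : modeAngle δ (c + 2) (0 : Fin (c + 1)).castSucc = -(δ * (c + 1)) := by
    simp only [modeAngle, Fin.val_castSucc, Fin.val_zero]
    push_cast
    ring
  have hlast : modeAngle δ (c + 2) (Fin.last (c + 1)) = δ * (c + 1) := by
    simp only [modeAngle, Fin.val_last]
    push_cast
    ring
  rw [cosProd, Fin.prod_univ_castSucc, Fin.prod_univ_succ, hfirst, hlast, neg_div, cos_neg]
  simp only [hmid, cosProd]
  ring

theorem cosProd_pi_div_two_mul (m p : ℕ) : cosProd (π / m) (2 * p) =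
    ∏ j ∈ Icc 1 p, (2 * cos (π * (2 * (j : ℝ) - 1) / (2 * (m : ℝ)))) ^ 2 := by
  induction p with
  | zero => simp [cosProd]
  | succ p ih =>
    rw [prod_Icc_succ_top (Nat.le_add_left 1 p), mul_add_one, cosProd_add_two, ih, mul_comm]
    congr 4
    push_cast
    field_simp
    ring

theorem cosProd_pi_div_two_mul_nonneg (m p : ℕ) : 0 ≤ cosProd (π / m) (2 * p) := by
  rw [cosProd_pi_div_two_mul]
  exact prod_nonneg fun _ _ => sq_nonneg _

theorem one_le_sq_two_mul_cos {t : ℝ} (h₀ : 0 ≤ t) (h : t ≤ π / 3) : 1 ≤ (2 * cos t) ^ 2 := by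
  have hcos := cos_le_cos_of_nonneg_of_le_pi h₀ (by linarith [pi_pos]) h
  rw [cos_pi_div_three] at hcos
  exact one_le_pow₀ (by linarith)

theorem sq_two_mul_cos_le_one {t : ℝ} (h : π / 3 ≤ t) (h' : t ≤ π - π / 3) :
    (2 * cos t) ^ 2 ≤ 1 := by
  have hle := cos_le_cos_of_nonneg_of_le_pi (by positivity) (by linarith [pi_pos]) h
  have hge := cos_le_cos_of_nonneg_of_le_pi (by linarith [pi_pos]) (by linarith [pi_pos]) h'
  rw [cos_pi_sub] at hge
  rw [cos_pi_div_three] at hle hge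
  rw [sq_le_one_iff_abs_le_one, abs_le]
  constructor <;> linarith

theorem prod_le_prod_of_sdiff {ι R : Type*} [DecidableEq ι] [CommSemiring R] [PartialOrder R]
    [IsStrictOrderedRing R] {s t : Finset ι} {a : ι → R} (ha : ∀ i, 0 ≤ a i)
    (hs : ∀ i ∈ s \ t, a i ≤ 1) (ht : ∀ i ∈ t \ s, 1 ≤ a i) :
    ∏ i ∈ s, a i ≤ ∏ i ∈ t, a i := by
  rw [← prod_inter_mul_prod_sdiff s t, ← prod_inter_mul_prod_sdiff t s, inter_comm t s]
  exact mul_le_mul_of_nonneg_left ((prod_le_one (fun i _ => ha i) hs).trans (one_le_prod ht))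
    (prod_nonneg fun i _ => ha i)

theorem one_le_sq_two_mul_cos_mode {m j : ℕ} (hj : 1 ≤ j) (h : j ≤ (m + 1) / 3) :
    1 ≤ (2 * cos (π * (2 * (j : ℝ) - 1) / (2 * (m : ℝ)))) ^ 2 := by
  have hj' : (1 : ℝ) ≤ j := by exact_mod_cast hj
  have hm : (0 : ℝ) < m := by exact_mod_cast (by lia : 0 < m)
  have hle : (6 * j : ℝ) ≤ 2 * m + 3 := by exact_mod_cast (by lia : 6 * j ≤ 2 * m + 3)
  refine one_le_sq_two_mul_cos ?_ ?_
  · exact div_nonneg (mul_nonneg pi_pos.le (by linarith)) (by positivity)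
  · rw [div_le_iff₀ (by positivity)]
    linarith [mul_le_mul_of_nonneg_left hle pi_pos.le]

theorem sq_two_mul_cos_mode_le_one {m j : ℕ} (h : (m + 1) / 3 < j) (hj : 2 * j ≤ m) :
    (2 * cos (π * (2 * (j : ℝ) - 1) / (2 * (m : ℝ)))) ^ 2 ≤ 1 := by
  have hm : (0 : ℝ) < m := by exact_mod_cast (by lia : 0 < m)
  have hge : (2 * m + 3 : ℝ) ≤ 6 * j := by exact_mod_cast (by lia : 2 * m + 3 ≤ 6 * j)
  have hle : (2 * j : ℝ) ≤ m := by exact_mod_cast hj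
  refine sq_two_mul_cos_le_one ?_ ?_
  · rw [le_div_iff₀ (by positivity)]
    linarith [mul_le_mul_of_nonneg_left hge pi_pos.le]
  · rw [div_le_iff₀ (by positivity)]
    linarith [mul_le_mul_of_nonneg_left hle pi_pos.le, mul_pos pi_pos hm, pi_pos]

theorem cosProd_pi_div_two_mul_le {m p : ℕ} (hp : 2 * p ≤ m) :
    cosProd (π / m) (2 * p) ≤ cosProd (π / m) (2 * ((m + 1) / 3)) := by
  rw [cosProd_pi_div_two_mul, cosProd_pi_div_two_mul]
  refine prod_le_prod_of_sdiff (fun _ => sq_nonneg _) (fun j hj => ?_) fun j hj => ?_ <;>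
    simp only [mem_sdiff, mem_Icc] at hj
  · exact sq_two_mul_cos_mode_le_one (by lia) (by lia)
  · exact one_le_sq_two_mul_cos_mode (by lia) (by lia)

end DominantMode

section Steps

open Finset
open scoped Pointwise

/-- `X` is the union of the disjoint sets `A` and `B`. -/
def IsDisjUnion {α : Type*} [DecidableEq α] (X A B : Finset α) : Prop := Disjoint A B ∧ A ∪ B = X

theorem IsDisjUnion.card_eq {α : Type*} [DecidableEq α] {X A B : Finset α}
    (h : IsDisjUnion X A B) : X.card = A.card + B.card := by
  rw [← h.2, card_union_of_disjoint h.1]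

theorem isDisjUnion_iff {α : Type*} [DecidableEq α] {X A B : Finset α} :
    IsDisjUnion X A B ↔ ∀ a, (a ∈ X ↔ a ∈ A ∨ a ∈ B) ∧ ¬(a ∈ A ∧ a ∈ B) := by
  rw [IsDisjUnion, forall_and, and_comm, Finset.ext_iff, disjoint_left]
  simp only [mem_union, not_and, iff_comm]

/-- One ring of the barrel, read from the inside out. The set `X` consists of the positions at which
the ring has to cover its inward vertex, `Y` of those at which it has to cover its outward vertex,
and this is done by the ring edges `ringIn l, ringOut l` for `l ∈ A` and
`ringOut l, ringIn (l + 1)` for `l ∈ B`. -/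
def IsStep {m : ℕ} (X Y A B : Finset (ZMod m)) : Prop :=
  IsDisjUnion X A ((1 : ZMod m) +ᵥ B) ∧ IsDisjUnion Y A B

/-- The edges `l, l + 1` of an `m`-cycle for `l ∈ P` form a perfect matching of the vertices
in `X`. -/
def IsCap {m : ℕ} (X P : Finset (ZMod m)) : Prop := IsDisjUnion X P ((1 : ZMod m) +ᵥ P)

/-- The number of ways of passing a ring from state `X` to state `Y`. -/
noncomputable def stepCount {m : ℕ} (X Y : Finset (ZMod m)) : ℕ :=
  Nat.card {E : Finset (ZMod m) × Finset (ZMod m) // IsStep X Y E.1 E.2}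

/-- The number of ways of matching `X` inside an `m`-cycle. -/
noncomputable def capCount {m : ℕ} (X : Finset (ZMod m)) : ℕ :=
  Nat.card {P : Finset (ZMod m) // IsCap X P}

theorem IsStep.card_eq {m : ℕ} {X Y A B : Finset (ZMod m)} (h : IsStep X Y A B) :
    X.card = Y.card := by
  rw [h.1.card_eq, h.2.card_eq, card_vadd_finset]

theorem IsCap.even_card {m : ℕ} {X P : Finset (ZMod m)} (h : IsCap X P) : Even X.card :=
  ⟨P.card, by rw [IsDisjUnion.card_eq h, card_vadd_finset]⟩

theorem card_eq_of_stepCount_ne_zero {m : ℕ} {X Y : Finset (ZMod m)} (h : stepCount X Y ≠ 0) :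
    X.card = Y.card := by
  obtain ⟨⟨E, hE⟩⟩ := (Nat.card_ne_zero.1 h).1
  exact hE.card_eq

theorem even_card_of_capCount_ne_zero {m : ℕ} {X : Finset (ZMod m)} (h : capCount X ≠ 0) :
    Even X.card := by
  obtain ⟨⟨P, hP⟩⟩ := (Nat.card_ne_zero.1 h).1
  exact hP.even_card

theorem one_vadd_image_sub_one {m : ℕ} {ι : Type*} (x : ι → ZMod m) (s : Finset ι) :
    (1 : ZMod m) +ᵥ s.image (fun i => x i - 1) = s.image x := by
  simp [vadd_finset_def, image_image, Function.comp_def]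

variable {m : ℕ} {ι : Type*} [Fintype ι] [DecidableEq ι] {x : ι → ZMod m}

theorem image_moveBack (x : ι → ZMod m) (s : Finset ι) :
    univ.image (moveBack x s) = s.image x ∪ sᶜ.image fun i => x i - 1 := by
  rw [← union_compl s, image_union]
  congr 1 <;> refine image_congr fun i hi => ?_
  · exact s.piecewise_eq_of_mem _ _ (by simpa using hi)
  · exact s.piecewise_eq_of_notMem _ _ (by simpa using hi)

theorem injective_moveBack_iff (hx : Function.Injective x) {s : Finset ι} :
    Function.Injective (moveBack x s) ↔ Disjoint (s.image x) (sᶜ.image fun i => x i - 1) := by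
  rw [moveBack, ← piecewise_coe, Set.injective_piecewise_iff]
  have hx' : Function.Injective fun i => x i - 1 := sub_left_injective.comp hx
  simp only [hx.injOn, hx'.injOn, true_and, disjoint_left, mem_image, mem_coe, mem_compl]
  grind

theorem isStep_image_iff (hx : Function.Injective x) {Y A B : Finset (ZMod m)} :
    IsStep (univ.image x) Y A B ↔ ∃ s : Finset ι, Function.Injective (moveBack x s) ∧
      univ.image (moveBack x s) = Y ∧ s.image x = A ∧ (sᶜ.image fun i => x i - 1) = B := by
  constructor
  · rintro ⟨⟨hdisj, hunion⟩, hdisj', rfl⟩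
    have hA : ({i | x i ∈ A} : Finset ι).image x = A := by
      rw [← filter_image (p := (· ∈ A)), filter_mem_eq_inter, inter_eq_right, ← hunion]
      exact subset_union_left
    have hB : ({i | x i ∈ A} : Finset ι)ᶜ.image (fun i => x i - 1) = B := by
      refine vadd_left_cancel (1 : ZMod m) ?_
      rw [one_vadd_image_sub_one, compl_filter, ← filter_image (p := (· ∉ A)),
        filter_notMem_eq_sdiff, ← hunion, union_sdiff_cancel_left hdisj]
    exact ⟨_, (injective_moveBack_iff hx).2 (by rwa [hA, hB]),
      by rw [image_moveBack, hA, hB], hA, hB⟩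
  · rintro ⟨s, hs, rfl, rfl, rfl⟩
    refine ⟨⟨?_, ?_⟩, (injective_moveBack_iff hx).1 hs, (image_moveBack x s).symm⟩ <;>
      rw [one_vadd_image_sub_one]
    · exact (disjoint_image hx).2 disjoint_compl_right
    · rw [← image_union, union_compl]

theorem stepCount_moveBack_pos [NeZero m] (hx : Function.Injective x) {s : Finset ι}
    (hs : Function.Injective (moveBack x s)) :
    0 < stepCount (univ.image x) (univ.image (moveBack x s)) :=
  Nat.card_pos_iff.2 ⟨⟨⟨(_, _), (isStep_image_iff hx).2 ⟨s, hs, rfl, rfl, rfl⟩⟩⟩, inferInstance⟩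

theorem sum_stepCount_mul [NeZero m] (hx : Function.Injective x) (w : Finset (ZMod m) → ℝ)
    [DecidablePred fun s : Finset ι => Function.Injective (moveBack x s)] :
    ∑ Y, (stepCount (univ.image x) Y : ℝ) * w Y =
      ∑ s : Finset ι with Function.Injective (moveBack x s), w (univ.image (moveBack x s)) := by
  classical
  have hterm (Y : Finset (ZMod m)) : (stepCount (univ.image x) Y : ℝ) * w Y =
      ∑ E : Finset (ZMod m) × Finset (ZMod m),
        if IsStep (univ.image x) Y E.1 E.2 then w Y else 0 := by
    rw [← sum_filter, sum_const, nsmul_eq_mul, stepCount, Nat.card_eq_fintype_card,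
      Fintype.card_subtype]
  simp only [hterm]
  rw [← Fintype.sum_prod_type', ← sum_filter]
  symm
  refine sum_bij (fun s _ => (univ.image (moveBack x s), s.image x, sᶜ.image fun i => x i - 1))
    (fun s hs => ?_) (fun s _ t _ hst => ?_) ?_ fun _ _ => rfl
  · simp only [mem_filter_univ] at hs ⊢
    exact (isStep_image_iff hx).2 ⟨s, hs, rfl, rfl, rfl⟩
  · exact image_injective hx (Prod.mk.inj (Prod.mk.inj hst).2).1
  · rintro ⟨Y, A, B⟩ h
    rw [mem_filter_univ] at h
    obtain ⟨s, hs, rfl, rfl, rfl⟩ := (isStep_image_iff hx).1 h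
    exact ⟨s, (mem_filter_univ _).2 hs, rfl⟩

end Steps

section Lifts

open Finset

/-- The `c` integers `x` are listed in increasing order and lie in a window of length `m`, so that
they are the positions of `c` distinct particles on a ring of length `m`, unrolled. -/
def IsUnrolled (m : ℕ) {c : ℕ} (x : Fin c → ℤ) : Prop := StrictMono x ∧ ∀ i j, x i < x j + m

theorem IsUnrolled.injective {m c : ℕ} {x : Fin c → ℤ} (hx : IsUnrolled m x) :
    Function.Injective fun i => (x i : ZMod m) := by
  intro i j h
  have hdvd : (m : ℤ) ∣ x j - x i := (ZMod.intCast_eq_intCast_iff_dvd_sub _ _ _).1 h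
  have hsub : x j - x i = 0 := Int.eq_zero_of_abs_lt_dvd hdvd
    (abs_lt.2 ⟨by linarith [hx.2 i j], by linarith [hx.2 j i]⟩)
  exact hx.1.injective (by linarith)

theorem IsUnrolled.moveBack_mono {m c : ℕ} {x : Fin c → ℤ} (hx : IsUnrolled m x)
    (s : Finset (Fin c)) {i j : Fin c} (hij : i < j) :
    moveBack x s i ≤ moveBack x s j ∧ moveBack x s j ≤ moveBack x s i + m := by
  have hlt := hx.1 hij
  have hlt' := hx.2 j i
  by_cases hi : i ∈ s <;> by_cases hj : j ∈ s <;> simp [moveBack, hi, hj] <;> lia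

theorem exists_strictMono_intCast {m : ℕ} [NeZero m] (X : Finset (ZMod m)) :
    ∃ x : Fin X.card → ℤ, StrictMono x ∧ (∀ i, 0 ≤ x i ∧ x i < m) ∧
      univ.image (fun i => (x i : ZMod m)) = X := by
  let e := (X.image ZMod.val).orderEmbOfFin (card_image_of_injective X (ZMod.val_injective m))
  have himage : univ.image e = X.image ZMod.val := image_orderEmbOfFin_univ _ _
  refine ⟨fun i => e i, Nat.strictMono_cast.comp e.strictMono, fun i => ?_, ?_⟩
  · obtain ⟨a, -, ha⟩ := mem_image.1 (himage ▸ mem_image_of_mem e (mem_univ i))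
    exact ⟨Int.natCast_nonneg _, Int.ofNat_lt.2 (ha ▸ ZMod.val_lt a)⟩
  · calc univ.image (fun i => ((e i : ℤ) : ZMod m))
        = (univ.image e).image (Nat.cast : ℕ → ZMod m) := by
          simp [image_image, Function.comp_def]
      _ = X := by simp [himage, image_image, Function.comp_def]

end Lifts

section ChordProduct

open Finset Real

/-- `|sin (π a / m)|`, proportional to the distance of `0` and `a` on a regular `m`-gon. -/
noncomputable def chord {m : ℕ} (a : ZMod m) : ℝ := |sin (π / m * a.val)|

theorem chord_intCast {m : ℕ} [NeZero m] (n : ℤ) : chord (n : ZMod m) = |sin (π / m * n)| := by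
  have hm : (m : ℝ) ≠ 0 := NeZero.ne _
  have hn : (n : ℝ) = (n : ZMod m).val + m * (n / m : ℤ) := by
    have hdiv := Int.emod_add_mul_ediv n m
    rw [← ZMod.val_intCast] at hdiv
    exact_mod_cast hdiv.symm
  have hangle : π / m * n = π / m * (n : ZMod m).val + (n / m : ℤ) * π := by
    rw [hn]
    field_simp
  rw [hangle, sin_add_int_mul_pi, abs_mul, abs_zpow, abs_neg, abs_one, one_zpow, one_mul, chord]

theorem chord_pos {m : ℕ} [NeZero m] {a : ZMod m} (ha : a ≠ 0) : 0 < chord a := by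
  have hm : (0 : ℝ) < m := Nat.cast_pos.2 (NeZero.pos m)
  have hpos : (0 : ℝ) < a.val := Nat.cast_pos.2 (Nat.pos_of_ne_zero ((ZMod.val_ne_zero a).2 ha))
  have hlt : (a.val : ℝ) < m := Nat.cast_lt.2 (ZMod.val_lt a)
  refine abs_pos.2 (sin_pos_of_pos_of_lt_pi (by positivity) ?_).ne'
  rw [div_mul_eq_mul_div, div_lt_iff₀ hm]
  exact mul_lt_mul_of_pos_left hlt pi_pos

/-- The product of the chords between the points of `X`. The square root is there because each chord
occurs twice in the product over ordered pairs. -/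
noncomputable def chordProd {m : ℕ} (X : Finset (ZMod m)) : ℝ :=
  √(∏ a ∈ X, ∏ b ∈ X.erase a, chord (a - b))

theorem chordProd_pos {m : ℕ} [NeZero m] (X : Finset (ZMod m)) : 0 < chordProd X :=
  sqrt_pos.2 (prod_pos fun _ _ => prod_pos fun _ hb =>
    chord_pos (sub_ne_zero.2 (ne_of_mem_erase hb).symm))

theorem chordProd_image_intCast {m c : ℕ} [NeZero m] {x : Fin c → ℤ}
    (hx : Function.Injective fun i => (x i : ZMod m)) :
    chordProd (univ.image fun i => (x i : ZMod m)) = |sinProd (π / m) fun i => (x i : ℝ)| := by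
  have hchord (i j : Fin c) :
      chord ((x i : ZMod m) - (x j : ZMod m)) = |sin (π / m * (x i - x j))| := by
    rw [← Int.cast_sub, chord_intCast, Int.cast_sub]
  have hcomm (i j : Fin c) : |sin (π / m * (x i - x j))| = |sin (π / m * (x j - x i))| := by
    rw [← abs_neg, ← sin_neg, ← mul_neg, neg_sub]
  have hpairs := prod_prod_Ioi_mul_eq_prod_prod_off_diag
    fun j i : Fin c => |sin (π / m * (x i - x j))|
  rw [chordProd, ← sqrt_sq_eq_abs, prod_image hx.injOn, sinProd, ← sq_abs]
  congr 1
  simp only [← image_erase hx, prod_image hx.injOn, hchord, abs_prod, sq, ← prod_mul_distrib]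
  simp only [← compl_singleton, ← hpairs]
  exact prod_congr rfl fun i _ => prod_congr rfl fun j _ => by rw [hcomm i j]

theorem sinProd_intCast_eq_zero {m c : ℕ} [NeZero m] {x : Fin c → ℤ}
    (hx : ¬ Function.Injective fun i => (x i : ZMod m)) :
    sinProd (π / m) (fun i => (x i : ℝ)) = 0 := by
  have hm : (m : ℝ) ≠ 0 := NeZero.ne _
  have hzero (i j : Fin c) (hij : i < j) (h : (x i : ZMod m) = x j) :
      sinProd (π / m) (fun i => (x i : ℝ)) = 0 := by
    obtain ⟨d, hd⟩ := (ZMod.intCast_eq_intCast_iff_dvd_sub _ _ _).1 h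
    have hd' : (x j : ℝ) - x i = m * d := by exact_mod_cast hd
    refine prod_eq_zero (mem_univ i) (prod_eq_zero (mem_Ioi.2 hij) ?_)
    rw [hd', sin_eq_zero_iff]
    exact ⟨d, by field_simp⟩
  rw [Function.Injective] at hx
  push Not at hx
  obtain ⟨i, j, h, hij⟩ := hx
  rcases lt_or_gt_of_ne hij with hlt | hgt
  exacts [hzero i j hlt h, hzero j i hgt h.symm]

theorem sinProd_nonneg {δ : ℝ} {c : ℕ} {x : Fin c → ℝ}
    (hx : ∀ i j, i < j → 0 ≤ δ * (x j - x i) ∧ δ * (x j - x i) ≤ π) : 0 ≤ sinProd δ x :=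
  prod_nonneg fun i _ => prod_nonneg fun j hj =>
    have h := hx i j (mem_Ioi.1 hj)
    sin_nonneg_of_nonneg_of_le_pi h.1 h.2

theorem IsUnrolled.sinProd_moveBack_nonneg {m c : ℕ} [NeZero m] {x : Fin c → ℤ}
    (hx : IsUnrolled m x) (s : Finset (Fin c)) :
    0 ≤ sinProd (π / m) (fun i => ((moveBack x s i : ℤ) : ℝ)) := by
  have hm : (0 : ℝ) < m := Nat.cast_pos.2 (NeZero.pos m)
  refine sinProd_nonneg fun i j hij => ?_
  obtain ⟨hle, hle'⟩ := hx.moveBack_mono s hij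
  have h : ((moveBack x s i : ℤ) : ℝ) ≤ moveBack x s j := by exact_mod_cast hle
  have h' : ((moveBack x s j : ℤ) : ℝ) ≤ moveBack x s i + m := by exact_mod_cast hle'
  refine ⟨mul_nonneg (by positivity) (by linarith), ?_⟩
  rw [div_mul_eq_mul_div, div_le_iff₀ hm]
  exact mul_le_mul_of_nonneg_left (by linarith) pi_pos.le

theorem sum_stepCount_mul_chordProd {m : ℕ} [NeZero m] (X : Finset (ZMod m)) :
    ∑ Y, (stepCount X Y : ℝ) * chordProd Y = cosProd (π / m) X.card * chordProd X := by
  classical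
  obtain ⟨x, hmono, hx, hX⟩ := exists_strictMono_intCast X
  generalize X.card = c at x hmono hx hX
  subst hX
  have hx : IsUnrolled m x := ⟨hmono, fun i j => by linarith [hx i, hx j]⟩
  have hcast (s : Finset (Fin c)) : moveBack (fun i => (x i : ZMod m)) s =
      fun i => ((moveBack x s i : ℤ) : ZMod m) :=
    (comp_moveBack (Int.castRingHom (ZMod m)) x s).symm
  have hcast' (s : Finset (Fin c)) :
      moveBack (fun i => (x i : ℝ)) s =
      fun i => ((moveBack x s i : ℤ) : ℝ) := (comp_moveBack (Int.castRingHom ℝ) x s).symm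
  have hx₀ : 0 ≤ sinProd (π / m) (fun i => (x i : ℝ)) := by
    simpa [moveBack] using hx.sinProd_moveBack_nonneg univ
  rw [sum_stepCount_mul hx.injective, chordProd_image_intCast hx.injective, abs_of_nonneg hx₀,
    ← sum_sinProd_moveBack, sum_filter]
  refine sum_congr rfl fun s _ => ?_
  rw [hcast, hcast']
  split_ifs with hs
  · rw [chordProd_image_intCast hs, abs_of_nonneg (hx.sinProd_moveBack_nonneg s)]
  · rw [sinProd_intCast_eq_zero hs]

end ChordProduct

section TransferMatrix

open Finset
open scoped Pointwise

/-- The matrix whose powers count the ways of passing several rings in a row. -/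
noncomputable def transferMatrix (m : ℕ) : Matrix (Finset (ZMod m)) (Finset (ZMod m)) ℝ :=
  Matrix.of fun X Y => (stepCount X Y : ℝ)

variable {m c : ℕ} {x y : Fin c → ℤ}

theorem transferMatrix_nonneg (X Y : Finset (ZMod m)) : 0 ≤ transferMatrix m X Y :=
  Nat.cast_nonneg _

theorem IsUnrolled.sub_const (hx : IsUnrolled m x) (a : ℤ) : IsUnrolled m fun i => x i - a :=
  ⟨fun _ _ hij => sub_lt_sub_right (hx.1 hij) a, fun i j => by linarith [hx.2 i j]⟩

theorem IsUnrolled.max (hx : IsUnrolled m x) (hy : IsUnrolled m y) :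
    IsUnrolled m fun i => max (x i) (y i) :=
  ⟨fun _ _ hij => max_lt_max (hx.1 hij) (hy.1 hij), fun i j => by
    have h := hx.2 i j
    have h' := hy.2 i j
    lia⟩

theorem transferMatrix_moveBack_pos [NeZero m] (hx : IsUnrolled m x) {s : Finset (Fin c)}
    (hs : IsUnrolled m (moveBack x s)) :
    0 < transferMatrix m (univ.image fun i => (x i : ZMod m))
      (univ.image fun i => ((moveBack x s i : ℤ) : ZMod m)) := by
  have hcast : (fun i => ((moveBack x s i : ℤ) : ZMod m)) = moveBack (fun i => (x i : ZMod m)) s :=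
    comp_moveBack (Int.castRingHom (ZMod m)) x s
  have hinj := hs.injective
  rw [hcast] at hinj ⊢
  exact Nat.cast_pos.2 (stepCount_moveBack_pos hx.injective hinj)

theorem max_sub_succ_eq_moveBack (x y : Fin c → ℤ) (n : ℕ) :
    (fun i => max (x i - (n + 1 : ℕ)) (y i)) =
      moveBack (fun i => max (x i - n) (y i)) {i | x i - n ≤ y i} := by
  funext i
  simp only [moveBack, Finset.piecewise, mem_filter_univ]
  split_ifs <;> lia

-- The particles walk from `x` down to `y`, each of them stopping as soon as it arrives.
theorem transferMatrix_pow_pos_of_le [NeZero m] (hx : IsUnrolled m x) (hy : IsUnrolled m y)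
    (hyx : y ≤ x) (n : ℕ) :
    0 < (transferMatrix m ^ n) (univ.image fun i => (x i : ZMod m))
      (univ.image fun i => ((max (x i - n) (y i) : ℤ) : ZMod m)) := by
  induction n with
  | zero =>
    have hmax (i : Fin c) : max (x i - (0 : ℕ)) (y i) = x i := by simpa using hyx i
    simp only [hmax, pow_zero, Matrix.one_apply_eq, zero_lt_one]
  | succ n ih =>
    have hmax := max_sub_succ_eq_moveBack x y n
    have hnext := (hx.sub_const (n + 1 : ℕ)).max hy
    rw [hmax] at hnext
    simp only [congrFun hmax]
    exact pow_succ_apply_pos transferMatrix_nonneg ih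
      (transferMatrix_moveBack_pos ((hx.sub_const n).max hy) hnext)

theorem transferMatrix_pow_two_mul_pos [NeZero m] {X Y : Finset (ZMod m)} (h : X.card = Y.card) :
    0 < (transferMatrix m ^ (2 * m)) X Y := by
  obtain ⟨x, hx, hx', hX⟩ := exists_strictMono_intCast X
  obtain ⟨y, hy, hy', hY⟩ := exists_strictMono_intCast Y
  generalize X.card = c at x hx hx' hX h
  subst h
  have hxu : IsUnrolled m x := ⟨hx, fun i j => by linarith [hx' i, hx' j]⟩
  have hyu : IsUnrolled m y := ⟨hy, fun i j => by linarith [hy' i, hy' j]⟩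
  have hpos := transferMatrix_pow_pos_of_le hxu (hyu.sub_const m)
    (fun i => by linarith [hx' i, hy' i]) (2 * m)
  have hmax (i) : max (x i - (2 * m : ℕ)) (y i - m) = y i - m :=
    max_eq_right (by push_cast; linarith [hx' i, hy' i])
  simp only [hmax, hX] at hpos
  simpa [hY] using hpos

theorem card_eq_of_transferMatrix_ne_zero (X Y : Finset (ZMod m)) (h : transferMatrix m X Y ≠ 0) :
    X.card = Y.card :=
  card_eq_of_stepCount_ne_zero (Nat.cast_ne_zero.1 h)

theorem exists_card_eq_and_capCount_pos [NeZero m] {p : ℕ} (hp : 2 * p ≤ m) :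
    ∃ X : Finset (ZMod m), X.card = 2 * p ∧ 0 < capCount X := by
  let evens : Finset (ZMod m) := (range p).image fun i => ((2 * i : ℕ) : ZMod m)
  have hinj {a b : ℕ} (ha : a < m) (hb : b < m) (h : (a : ZMod m) = b) : a = b :=
    CharP.natCast_injOn_Iio (ZMod m) m ha hb h
  have hcard : evens.card = p := by
    rw [card_image_of_injOn, card_range]
    intro i hi j hj hij
    simp only [coe_range, Set.mem_Iio] at hi hj
    have := hinj (by lia) (by lia) hij
    lia
  have hdisj : Disjoint evens ((1 : ZMod m) +ᵥ evens) := by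
    simp only [disjoint_left, evens, mem_vadd_finset, mem_image, mem_range, vadd_eq_add]
    rintro _ ⟨i, hi, rfl⟩ ⟨_, ⟨j, hj, rfl⟩, hij⟩
    have := hinj (a := 1 + 2 * j) (b := 2 * i) (by lia) (by lia) (by exact_mod_cast hij)
    lia
  have hcap : IsCap (evens ∪ ((1 : ZMod m) +ᵥ evens)) evens := ⟨hdisj, rfl⟩
  refine ⟨_, ?_, Nat.card_pos_iff.2 ⟨⟨⟨evens, hcap⟩⟩, inferInstance⟩⟩
  rw [IsDisjUnion.card_eq hcap, card_vadd_finset, hcard, two_mul]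

end TransferMatrix

section EdgeIndexing

variable {V E : Type*} {G : SimpleGraph V} {ends : E → Sym2 V}

/-- The spanning subgraph whose edges are those indexed by `S`. -/
def spanningSubgraph (hends : Set.range ends = G.edgeSet) (S : Set E) : G.Subgraph where
  verts := Set.univ
  Adj v w := ∃ e ∈ S, ends e = s(v, w)
  adj_sub := fun ⟨e, _, he⟩ => by
    rw [← SimpleGraph.mem_edgeSet, ← hends, ← he]
    exact Set.mem_range_self e
  edge_vert _ := Set.mem_univ _
  symm := ⟨fun v w ⟨e, heS, he⟩ => ⟨e, heS, he.trans Sym2.eq_swap⟩⟩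

theorem isPerfectMatching_spanningSubgraph_iff (hends : Set.range ends = G.edgeSet)
    (hinj : Function.Injective ends) (S : Set E) :
    (spanningSubgraph hends S).IsPerfectMatching ↔ ∀ v, ∃! e, e ∈ S ∧ v ∈ ends e := by
  rw [SimpleGraph.Subgraph.isPerfectMatching_iff]
  refine forall_congr' fun v => ⟨?_, ?_⟩
  · rintro ⟨w, ⟨e, heS, he⟩, hw⟩
    refine ⟨e, ⟨heS, he ▸ Sym2.mem_mk_left v w⟩, fun e' ⟨he'S, w', he'⟩ => hinj ?_⟩
    rw [he', he, hw w' ⟨e', he'S, he'⟩]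
  · rintro ⟨e, ⟨heS, w, he⟩, hunique⟩
    refine ⟨w, ⟨e, heS, he⟩, fun w' ⟨e', he'S, he'⟩ => ?_⟩
    have hee' : e' = e := hunique e' ⟨he'S, he' ▸ Sym2.mem_mk_left v w'⟩
    exact Sym2.congr_right.1 (he'.symm.trans (hee' ▸ he))

theorem numPerfectMatchings_eq_card_set (hends : Set.range ends = G.edgeSet)
    (hinj : Function.Injective ends) :
    numPerfectMatchings G = Nat.card {S : Set E // ∀ v, ∃! e, e ∈ S ∧ v ∈ ends e} := by
  refine (Nat.card_congr (Equiv.ofBijective (fun S => ⟨spanningSubgraph hends S.1,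
    (isPerfectMatching_spanningSubgraph_iff hends hinj S.1).2 S.2⟩) ⟨?_, ?_⟩)).symm
  · intro S T hST
    ext e
    induction h : ends e with | _ v w
    have hiff := iff_of_eq (congrArg (fun M => M.1.Adj v w) hST)
    simpa only [spanningSubgraph, ← h, hinj.eq_iff, exists_eq_right] using hiff
  · rintro ⟨M, hM⟩
    have hspan : spanningSubgraph hends {e | ends e ∈ M.edgeSet} = M := by
      refine SimpleGraph.Subgraph.ext (Set.eq_univ_of_forall hM.2).symm ?_
      ext v w
      refine ⟨fun ⟨e, heM, he⟩ => by simpa [he] using heM, fun h => ?_⟩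
      obtain ⟨e, he⟩ : s(v, w) ∈ Set.range ends := hends ▸ h.adj_sub
      exact ⟨e, by simpa [he] using h, he⟩
    exact ⟨⟨{e | ends e ∈ M.edgeSet},
      (isPerfectMatching_spanningSubgraph_iff hends hinj _).1 (hspan.symm ▸ hM)⟩, Subtype.ext hspan⟩

end EdgeIndexing

theorem existsUnique_mem_and_eq_or_eq_or_eq_iff {α : Type*} {S : Set α} {a b c : α} (hab : a ≠ b)
    (hac : a ≠ c) (hbc : b ≠ c) :
    (∃! e, e ∈ S ∧ (e = a ∨ e = b ∨ e = c)) ↔ (a ∉ S ↔ b ∈ S ∨ c ∈ S) ∧ ¬(b ∈ S ∧ c ∈ S) := by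
  simp only [ExistsUnique]
  grind

theorem natCast_zmod_ne_zero {m a : ℕ} (ha : 0 < a) (ham : a < m) : (a : ZMod m) ≠ 0 := by
  rw [Ne, ZMod.natCast_eq_zero_iff]
  exact Nat.not_dvd_of_pos_of_lt ha ham

section Barrel

variable {m k : ℕ}

/-- The end of the spoke `l` of layer `i` on the smaller circle. -/
def lowEnd (i : Fin (k + 2)) (l : ZMod m) : BarrelVertex m k :=
  Fin.cases (.inner l) (fun j => .ringOut j l) i

/-- The end of the spoke `l` of layer `i` on the larger circle. -/
def upEnd (i : Fin (k + 2)) (l : ZMod m) : BarrelVertex m k :=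
  Fin.lastCases (.outer l) (fun j => .ringIn j l) i

@[simp] theorem lowEnd_eq_inner {i : Fin (k + 2)} {l l' : ZMod m} :
    lowEnd i l = .inner l' ↔ i = 0 ∧ l = l' := by
  cases i using Fin.cases <;> simp [lowEnd]

@[simp] theorem lowEnd_eq_ringOut {i : Fin (k + 2)} {j : Fin (k + 1)} {l l' : ZMod m} :
    lowEnd i l = .ringOut j l' ↔ i = j.succ ∧ l = l' := by
  cases i using Fin.cases <;> simp [lowEnd, (Fin.succ_ne_zero _).symm]

@[simp] theorem lowEnd_ne_ringIn {i : Fin (k + 2)} {j : Fin (k + 1)} {l l' : ZMod m} :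
    lowEnd i l ≠ .ringIn j l' := by
  cases i using Fin.cases <;> simp [lowEnd]

@[simp] theorem lowEnd_ne_outer {i : Fin (k + 2)} {l l' : ZMod m} : lowEnd i l ≠ .outer l' := by
  cases i using Fin.cases <;> simp [lowEnd]

@[simp] theorem upEnd_eq_outer {i : Fin (k + 2)} {l l' : ZMod m} :
    upEnd i l = .outer l' ↔ i = Fin.last (k + 1) ∧ l = l' := by
  cases i using Fin.lastCases <;> simp [upEnd]

@[simp] theorem upEnd_eq_ringIn {i : Fin (k + 2)} {j : Fin (k + 1)} {l l' : ZMod m} :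
    upEnd i l = .ringIn j l' ↔ i = j.castSucc ∧ l = l' := by
  cases i using Fin.lastCases <;> simp [upEnd, (Fin.castSucc_ne_last _).symm]

@[simp] theorem upEnd_ne_ringOut {i : Fin (k + 2)} {j : Fin (k + 1)} {l l' : ZMod m} :
    upEnd i l ≠ .ringOut j l' := by
  cases i using Fin.lastCases <;> simp [upEnd]

@[simp] theorem upEnd_ne_inner {i : Fin (k + 2)} {l l' : ZMod m} : upEnd i l ≠ .inner l' := by
  cases i using Fin.lastCases <;> simp [upEnd]

theorem lowEnd_inj {i i' : Fin (k + 2)} {l l' : ZMod m} :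
    lowEnd i l = lowEnd i' l' ↔ i = i' ∧ l = l' := by
  cases i using Fin.cases with
  | zero => exact eq_comm.trans (lowEnd_eq_inner.trans (by simp [eq_comm]))
  | succ j => exact eq_comm.trans (lowEnd_eq_ringOut.trans (by simp [eq_comm]))

theorem lowEnd_ne_upEnd {i i' : Fin (k + 2)} {l l' : ZMod m} : lowEnd i l ≠ upEnd i' l' := by
  cases i using Fin.cases <;> simp [lowEnd, eq_comm (b := upEnd _ _)]

theorem barrelEdge_lowEnd_upEnd (i : Fin (k + 2)) (l : ZMod m) :
    BarrelEdge m k (lowEnd i l) (upEnd i l) := by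
  cases i using Fin.cases with
  | zero =>
    have hup : upEnd (0 : Fin (k + 2)) l = .ringIn 0 l := by simp
    exact hup ▸ .innerSpoke l
  | succ j =>
    cases j using Fin.lastCases with
    | last =>
      have hup : upEnd (Fin.last k).succ l = .outer l := by simp
      exact hup ▸ .outerSpoke l
    | cast j =>
      have hup : upEnd j.castSucc.succ l = .ringIn j.succ l := by simp
      exact hup ▸ .spoke j l

theorem BarrelEdge.ne (hm : 1 < m) {v w : BarrelVertex m k} (h : BarrelEdge m k v w) : v ≠ w := by
  have h1 : (1 : ZMod m) ≠ 0 := mod_cast natCast_zmod_ne_zero one_pos hm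
  cases h <;> simp [h1]

/-- The edges of `F(m,k)` as a type. The spokes come in `k + 2` layers, the layer `i` joining the
`i`-th circle to the next one. -/
inductive EdgeIndex (m k : ℕ) : Type
  | inner (l : ZMod m)
  | spoke (i : Fin (k + 2)) (l : ZMod m)
  | ringFst (j : Fin (k + 1)) (l : ZMod m)
  | ringSnd (j : Fin (k + 1)) (l : ZMod m)
  | outer (l : ZMod m)

namespace EdgeIndex

/-- The pair of vertices joined by an edge. -/
def ends : EdgeIndex m k → Sym2 (BarrelVertex m k)
  | inner l => s(.inner l, .inner (l + 1))
  | spoke i l => s(lowEnd i l, upEnd i l)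
  | ringFst j l => s(.ringIn j l, .ringOut j l)
  | ringSnd j l => s(.ringOut j l, .ringIn j (l + 1))
  | outer l => s(.outer l, .outer (l + 1))

theorem inner_mem_ends {e : EdgeIndex m k} {l : ZMod m} :
    .inner l ∈ e.ends ↔ e = spoke 0 l ∨ e = inner l ∨ e = inner (l - 1) := by
  cases e <;>
    simp [ends, eq_comm (b := lowEnd _ _), eq_comm (b := upEnd _ _),
      eq_sub_iff_add_eq, eq_comm (a := l)]

theorem ringIn_mem_ends {e : EdgeIndex m k} {j : Fin (k + 1)} {l : ZMod m} :
    .ringIn j l ∈ e.ends ↔ e = spoke j.castSucc l ∨ e = ringFst j l ∨ e = ringSnd j (l - 1) := by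
  cases e <;>
    simp [ends, eq_comm (b := lowEnd _ _), eq_comm (b := upEnd _ _),
      eq_sub_iff_add_eq, eq_comm (a := l), eq_comm (a := j)]

theorem ringOut_mem_ends {e : EdgeIndex m k} {j : Fin (k + 1)} {l : ZMod m} :
    .ringOut j l ∈ e.ends ↔ e = spoke j.succ l ∨ e = ringFst j l ∨ e = ringSnd j l := by
  cases e <;>
    simp [ends, eq_comm (b := lowEnd _ _), eq_comm (b := upEnd _ _),
      eq_comm (a := l), eq_comm (a := j)]

theorem outer_mem_ends {e : EdgeIndex m k} {l : ZMod m} :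
    .outer l ∈ e.ends ↔ e = spoke (Fin.last (k + 1)) l ∨ e = outer l ∨ e = outer (l - 1) := by
  cases e <;>
    simp [ends, eq_comm (b := lowEnd _ _), eq_comm (b := upEnd _ _),
      eq_sub_iff_add_eq, eq_comm (a := l)]

theorem eq_spoke_of_ends_eq {e : EdgeIndex m k} {i : Fin (k + 2)} {l : ZMod m}
    (h : e.ends = s(lowEnd i l, upEnd i l)) : e = spoke i l := by
  cases e <;>
    simp only [ends, Sym2.eq_iff, lowEnd_inj, lowEnd_ne_upEnd, eq_comm (b := lowEnd i l),
      eq_comm (b := upEnd i l), lowEnd_eq_inner, lowEnd_eq_ringOut, lowEnd_ne_ringIn,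
      lowEnd_ne_outer, upEnd_eq_outer, upEnd_eq_ringIn, upEnd_ne_ringOut, upEnd_ne_inner] at h <;>
    grind [Fin.castSucc_lt_succ]

theorem exists_ends_eq {v w : BarrelVertex m k} (h : BarrelEdge m k v w) :
    ∃ e : EdgeIndex m k, e.ends = s(v, w) := by
  cases h with
  | innerCycle l => exact ⟨inner l, rfl⟩
  | ringCycle j l => exact ⟨ringFst j l, rfl⟩
  | ringCycle' j l => exact ⟨ringSnd j l, rfl⟩
  | outerCycle l => exact ⟨outer l, rfl⟩
  | innerSpoke l => exact ⟨spoke 0 l, by simp [ends]⟩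
  | spoke j l => exact ⟨spoke j.succ.castSucc l, by simp [ends]⟩
  | outerSpoke l => exact ⟨spoke (Fin.last (k + 1)) l, by simp [ends]⟩

theorem injective_ends (hm : 3 ≤ m) : Function.Injective (ends (m := m) (k := k)) := by
  have h1 (l : ZMod m) : l + 1 ≠ l := by
    simpa using natCast_zmod_ne_zero one_pos (by lia : 1 < m)
  have h2 : (2 : ZMod m) ≠ 0 := mod_cast natCast_zmod_ne_zero two_pos (by lia)
  intro e e' h
  cases e <;> cases e'
  case spoke.spoke => exact (eq_spoke_of_ends_eq h.symm).symm
  all_goals first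
    | exact eq_spoke_of_ends_eq h
    | exact (eq_spoke_of_ends_eq h.symm).symm
    | (simp only [ends, Sym2.eq_iff] at h; grind)

theorem range_ends (hm : 1 < m) :
    Set.range (ends (m := m) (k := k)) = (barrelFullerene m k).edgeSet := by
  refine Set.Subset.antisymm ?_ fun e => ?_
  · rintro _ ⟨e, rfl⟩
    have hadj {v w : BarrelVertex m k} (h : BarrelEdge m k v w) : (barrelFullerene m k).Adj v w :=
      ⟨h.ne hm, .inl h⟩
    cases e with
    | inner l => exact hadj (.innerCycle l)
    | spoke i l => exact hadj (barrelEdge_lowEnd_upEnd i l)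
    | ringFst j l => exact hadj (.ringCycle j l)
    | ringSnd j l => exact hadj (.ringCycle' j l)
    | outer l => exact hadj (.outerCycle l)
  · induction e with | _ v w
    rintro ⟨-, h | h⟩
    · exact exists_ends_eq h
    · exact Sym2.eq_swap ▸ exists_ends_eq h

end EdgeIndex

open Finset
open scoped Pointwise

theorem mem_one_vadd_iff {B : Finset (ZMod m)} {l : ZMod m} :
    l ∈ (1 : ZMod m) +ᵥ B ↔ l - 1 ∈ B := by
  rw [← neg_vadd_mem_iff, vadd_eq_add, neg_add_eq_sub]

/-- A set of edges of `F(m,k)`, given circle by circle and spoke layer by spoke layer. Of the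
spokes, `free i` collects those of layer `i` which are *not* in the set: these are the positions
whose ends have to be covered within their circles. The edges `ringFst j l` and `ringSnd j l` in the
set are those with `l ∈ (ring j).1` and `l ∈ (ring j).2`. -/
@[ext] structure EdgeSelection (m k : ℕ) : Type where
  free : Fin (k + 2) → Finset (ZMod m)
  inner : Finset (ZMod m)
  ring : Fin (k + 1) → Finset (ZMod m) × Finset (ZMod m)
  outer : Finset (ZMod m)

namespace EdgeSelection

/-- The selected edges. -/
def edges (d : EdgeSelection m k) : Set (EdgeIndex m k) :=
  {e | match e with
    | .inner l => l ∈ d.inner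
    | .spoke i l => l ∉ d.free i
    | .ringFst j l => l ∈ (d.ring j).1
    | .ringSnd j l => l ∈ (d.ring j).2
    | .outer l => l ∈ d.outer}

theorem bijective_edges [NeZero m] : Function.Bijective (edges (m := m) (k := k)) := by
  classical
  constructor
  · intro d d' h
    have h' e : e ∈ d.edges ↔ e ∈ d'.edges := by rw [h]
    ext x l
    · exact not_iff_not.1 (h' (.spoke x l))
    · exact h' (.inner _)
    · exact h' (.ringFst _ _)
    · exact h' (.ringSnd _ _)
    · exact h' (.outer _)
  · intro S
    refine ⟨⟨fun i => {l | .spoke i l ∉ S}, ({l | .inner l ∈ S} : Finset _),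
      fun j => (({l | .ringFst j l ∈ S} : Finset _), ({l | .ringSnd j l ∈ S} : Finset _)),
      ({l | .outer l ∈ S} : Finset _)⟩, ?_⟩
    ext e
    cases e <;> simp [edges]

/-- The condition on a selection of edges for being a perfect matching. -/
def IsPerfect (d : EdgeSelection m k) : Prop :=
  IsCap (d.free 0) d.inner ∧
    (∀ j : Fin (k + 1), IsStep (d.free j.castSucc) (d.free j.succ) (d.ring j).1 (d.ring j).2) ∧
    IsCap (d.free (Fin.last (k + 1))) d.outer

variable (d : EdgeSelection m k)

theorem isCap_inner_iff (hm : 1 < m) :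
    IsCap (d.free 0) d.inner ↔ ∀ l, ∃! e, e ∈ d.edges ∧ .inner l ∈ e.ends := by
  have hl (l : ZMod m) : l - 1 ≠ l := by simpa using natCast_zmod_ne_zero one_pos hm
  rw [IsCap, isDisjUnion_iff]
  refine forall_congr' fun l => ?_
  simp only [EdgeIndex.inner_mem_ends]
  rw [existsUnique_mem_and_eq_or_eq_or_eq_iff (by simp) (by simp) (by simpa using (hl l).symm),
    mem_one_vadd_iff]
  simp only [edges, Set.mem_ofPred_eq, not_not]

theorem isCap_outer_iff (hm : 1 < m) :
    IsCap (d.free (Fin.last (k + 1))) d.outer ↔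
      ∀ l, ∃! e, e ∈ d.edges ∧ .outer l ∈ e.ends := by
  have hl (l : ZMod m) : l - 1 ≠ l := by simpa using natCast_zmod_ne_zero one_pos hm
  rw [IsCap, isDisjUnion_iff]
  refine forall_congr' fun l => ?_
  simp only [EdgeIndex.outer_mem_ends]
  rw [existsUnique_mem_and_eq_or_eq_or_eq_iff (by simp) (by simp) (by simpa using (hl l).symm),
    mem_one_vadd_iff]
  simp only [edges, Set.mem_ofPred_eq, not_not]

theorem isStep_iff (j : Fin (k + 1)) :
    IsStep (d.free j.castSucc) (d.free j.succ) (d.ring j).1 (d.ring j).2 ↔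
      (∀ l, ∃! e, e ∈ d.edges ∧ .ringIn j l ∈ e.ends) ∧
        ∀ l, ∃! e, e ∈ d.edges ∧ .ringOut j l ∈ e.ends := by
  simp only [IsStep, isDisjUnion_iff, EdgeIndex.ringIn_mem_ends, EdgeIndex.ringOut_mem_ends]
  refine and_congr (forall_congr' fun l => ?_) (forall_congr' fun l => ?_) <;>
    rw [existsUnique_mem_and_eq_or_eq_or_eq_iff (by simp) (by simp) (by simp)]
  · rw [mem_one_vadd_iff]
    simp only [edges, Set.mem_ofPred_eq, not_not]
  · simp only [edges, Set.mem_ofPred_eq, not_not]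

theorem isPerfect_iff (hm : 1 < m) :
    d.IsPerfect ↔ ∀ v, ∃! e, e ∈ d.edges ∧ v ∈ e.ends := by
  simp only [IsPerfect, d.isCap_inner_iff hm, d.isCap_outer_iff hm, isStep_iff]
  refine ⟨fun ⟨hinner, hring, houter⟩ v => ?_, fun h =>
    ⟨fun l => h _, fun j => ⟨fun l => h _, fun l => h _⟩, fun l => h _⟩⟩
  cases v with
  | inner l => exact hinner l
  | ringIn j l => exact (hring j).1 l
  | ringOut j l => exact (hring j).2 l
  | outer l => exact houter l

/-- Perfect selections, grouped by their free spokes. -/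
def perfectEquiv : {d : EdgeSelection m k // d.IsPerfect} ≃
    Σ X : Fin (k + 2) → Finset (ZMod m), {P // IsCap (X 0) P} ×
      (∀ j : Fin (k + 1), {E : Finset (ZMod m) × Finset (ZMod m) //
        IsStep (X j.castSucc) (X j.succ) E.1 E.2}) × {P // IsCap (X (Fin.last (k + 1))) P} where
  toFun d := ⟨d.1.free, ⟨d.1.inner, d.2.1⟩, fun j => ⟨d.1.ring j, d.2.2.1 j⟩, ⟨d.1.outer, d.2.2.2⟩⟩
  invFun x := ⟨⟨x.1, x.2.1.1, fun j => (x.2.2.1 j).1, x.2.2.2.1⟩,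
    x.2.1.2, fun j => (x.2.2.1 j).2, x.2.2.2.2⟩

end EdgeSelection

theorem numPerfectMatchings_barrelFullerene_eq_card (hm : 3 ≤ m) :
    numPerfectMatchings (barrelFullerene m k) =
      Nat.card {d : EdgeSelection m k // d.IsPerfect} := by
  have : NeZero m := ⟨by lia⟩
  rw [numPerfectMatchings_eq_card_set (EdgeIndex.range_ends (by lia)) (EdgeIndex.injective_ends hm)]
  refine (Nat.card_congr ((Equiv.ofBijective _ EdgeSelection.bijective_edges).subtypeEquiv ?_)).symm
  exact fun d => d.isPerfect_iff (by lia)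

end Barrel

section Count

open Matrix Filter Asymptotics Real

variable {m : ℕ}

theorem numPerfectMatchings_barrelFullerene [NeZero m] (hm : 3 ≤ m) (k : ℕ) :
    (numPerfectMatchings (barrelFullerene m k) : ℝ) = (fun X => (capCount X : ℝ)) ⬝ᵥ
      (transferMatrix m ^ (k + 1) *ᵥ fun X => (capCount X : ℝ)) := by
  rw [numPerfectMatchings_barrelFullerene_eq_card hm, Nat.card_congr EdgeSelection.perfectEquiv,
    ← sum_walks_eq_dotProduct_pow_mulVec, Nat.card_sigma]
  simp only [Nat.card_prod, Nat.card_pi]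
  push_cast
  simp only [capCount, stepCount, transferMatrix, of_apply, mul_assoc]

theorem abs_cosProd_card_le [NeZero m] {X : Finset (ZMod m)} (hX : (capCount X : ℝ) ≠ 0) :
    |cosProd (π / m) X.card| ≤ cosProd (π / m) (2 * ((m + 1) / 3)) := by
  obtain ⟨p, hp⟩ := even_iff_two_dvd.1 (even_card_of_capCount_ne_zero (Nat.cast_ne_zero.1 hX))
  have hpm : 2 * p ≤ m := hp ▸ (Finset.card_le_univ X).trans (ZMod.card m).le
  rw [hp, abs_of_nonneg (cosProd_pi_div_two_mul_nonneg m p)]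
  exact cosProd_pi_div_two_mul_le hpm

theorem isTheta_dotProduct_transferMatrix_pow [NeZero m] (hm : m ≠ 1) :
    (fun n : ℕ => (fun X => (capCount X : ℝ)) ⬝ᵥ
      (transferMatrix m ^ n *ᵥ fun X => (capCount X : ℝ))) =Θ[atTop]
      fun n => cosProd (π / m) (2 * ((m + 1) / 3)) ^ n := by
  have hm₀ := NeZero.ne m
  obtain ⟨X, hX, hXpos⟩ := exists_card_eq_and_capCount_pos (m := m) (p := (m + 1) / 3) (by lia)
  rw [← hX]
  exact isTheta_dotProduct_pow_mulVec (μ := cosProd (π / m)) (κ := Finset.card) (N := 2 * m)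
    transferMatrix_nonneg card_eq_of_transferMatrix_ne_zero chordProd_pos
    sum_stepCount_mul_chordProd (fun _ => Nat.cast_nonneg _) (fun _ => Nat.cast_nonneg _)
    (fun _ hY => hX ▸ abs_cosProd_card_le hY) (fun _ hY => transferMatrix_pow_two_mul_pos hY)
    (Nat.cast_pos.2 hXpos) (Nat.cast_pos.2 hXpos)

theorem isTheta_numPerfectMatchings_barrelFullerene (hm : 3 ≤ m) :
    (fun k => (numPerfectMatchings (barrelFullerene m k) : ℝ)) =Θ[atTop]
      fun k => cosProd (π / m) (2 * ((m + 1) / 3)) ^ k := by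
  have : NeZero m := ⟨by lia⟩
  have hρ : cosProd (π / m) (2 * ((m + 1) / 3)) ≠ 0 := by
    have hone := cosProd_pi_div_two_mul_le (m := m) (p := 0) (Nat.zero_le m)
    rw [cosProd_pi_div_two_mul m 0, Finset.Icc_eq_empty (by simp), Finset.prod_empty] at hone
    exact (one_pos.trans_le hone).ne'
  obtain ⟨hle, hge⟩ := isTheta_dotProduct_transferMatrix_pow (m := m) (by lia)
  have hshift := And.intro (hle.comp_tendsto (tendsto_add_atTop_nat 1))
    (hge.comp_tendsto (tendsto_add_atTop_nat 1))
  simp only [Function.comp_def, pow_succ' (cosProd _ _)] at hshift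
  simpa only [numPerfectMatchings_barrelFullerene hm] using (isTheta_const_mul_right hρ).1 hshift

end Count

theorem mainTheorem1 (m : ℕ) (hm : 3 ≤ m) :
    Filter.Tendsto
      (fun k : ℕ => (numPerfectMatchings (barrelFullerene m k) : ℝ) ^ (1 / (k : ℝ)))
      Filter.atTop
      (nhds (∏ j ∈ Finset.Icc 1 ((m + 1) / 3),
        (2 * Real.cos (Real.pi * (2 * (j : ℝ) - 1) / (2 * (m : ℝ)))) ^ 2)) := by
  rw [← cosProd_pi_div_two_mul]
  exact tendsto_rpow_one_div_of_isTheta_pow (fun k => Nat.cast_nonneg _)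
    (cosProd_pi_div_two_mul_nonneg m _) (isTheta_numPerfectMatchings_barrelFullerene hm)
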